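/- Let $V$ be a finite-dimensional real inner product space and let $G \subseteq \mathrm{GL}(V)$ be a compact subgroup whose elements are orthogonal. Suppose that $G$ is polar with Cartan subspace $\mathfrak{a}$, that is, $\mathfrak{a} \subseteq V$ is a linear subspace such that (A) every orbit $Gv$, $v \in V$, meets $\mathfrak{a}$, and (B) for every $u \in \mathfrak{a}$ the tangent space $T_u(Gu)$ is orthogonal to $\mathfrak{a}$. Let $W = \{g \in G : g\mathfrak{a} = \mathfrak{a}\}|_{\mathfrak{a}} \subseteq \mathrm{GL}(\mathfrak{a})$ be the Weyl group. For a subgroup $H$ of $\mathrm{GL}(E)$, where $E$ is a finite-dimensional real vector space, let $\mathfrak{C}(E,H)$ be the semigroup, under Minkowski addition $A + B = \{a + b : a \in A,\ b \in B\}$, of all $H$-invariant convex subsets of $E$ (the empty set included). Then the map $A \mapsto A \cap \mathfrak{a}$ is a semigroup isomorphism from $\mathfrak{C}(V,G)$ onto $\mathfrak{C}(\mathfrak{a},W)$. Moreover, if $\pi : V \to \mathfrak{a}$ denotes the orthogonal projection, then $\pi(A) = A \cap \mathfrak{a}$ for every $A \in \mathfrak{C}(V,G)$. -/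

import Mathlib

open scoped Pointwise

/-- The tangent space at `u` of the orbit `G u`, as a linear subspace of `V`. An orbit of a compact
linear group is a closed embedded submanifold of `V`, and at a point of such a submanifold the
tangent cone is the tangent space. -/
def orbitTangentSpace {V : Type*} [NormedAddCommGroup V] [NormedSpace ℝ V]
    (G : Subgroup (V →L[ℝ] V)ˣ) (u : V) : Submodule ℝ V :=
  Submodule.span ℝ (tangentConeAt ℝ (MulAction.orbit G u) u)

/-- `𝔞` is a Cartan subspace of the linear group `G`: every `G`-orbit meets `𝔞`, and at each point
`u` of `𝔞` the tangent space of the orbit `G u` is orthogonal to `𝔞`. The group `G` is called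
polar if it has a Cartan subspace. -/
structure IsCartanSubspace {V : Type*} [NormedAddCommGroup V] [InnerProductSpace ℝ V]
    (G : Subgroup (V →L[ℝ] V)ˣ) (𝔞 : Submodule ℝ V) : Prop where
  orbit_meets : ∀ v : V, (MulAction.orbit G v ∩ (𝔞 : Set V)).Nonempty
  tangent_orthogonal : ∀ u ∈ 𝔞, orbitTangentSpace G u ⟂ 𝔞

/-- The Weyl group `W = {g ∈ G : g 𝔞 = 𝔞}|_𝔞`, as a subgroup of `GL(𝔞)`. -/
def weylGroup {V : Type*} [NormedAddCommGroup V] [NormedSpace ℝ V]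
    (G : Subgroup (V →L[ℝ] V)ˣ) (𝔞 : Submodule ℝ V) : Subgroup (𝔞 →L[ℝ] 𝔞)ˣ where
  carrier := {w | ∃ g ∈ G, g • (𝔞 : Set V) = (𝔞 : Set V) ∧ ∀ x : 𝔞, ((w • x : 𝔞) : V) = g • (x : V)}
  one_mem' := ⟨1, G.one_mem, by simp, by simp⟩
  mul_mem' := by
    rintro w₁ w₂ ⟨g₁, hg₁, h₁, e₁⟩ ⟨g₂, hg₂, h₂, e₂⟩
    refine ⟨g₁ * g₂, G.mul_mem hg₁ hg₂, by rw [mul_smul, h₂, h₁], fun x => ?_⟩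
    rw [mul_smul, mul_smul, e₁, e₂]
  inv_mem' := by
    rintro w ⟨g, hg, h, e⟩
    refine ⟨g⁻¹, G.inv_mem hg, by rw [inv_smul_eq_iff, h], fun x => ?_⟩
    rw [eq_inv_smul_iff, ← e, smul_inv_smul]

/-- The semigroup, under Minkowski addition, of all `H`-invariant convex subsets of `E`. -/
def invariantConvexSets {E : Type*} [NormedAddCommGroup E] [NormedSpace ℝ E]
    (H : Subgroup (E →L[ℝ] E)ˣ) : AddSubsemigroup (Set E) where
  carrier := {A | Convex ℝ A ∧ ∀ h ∈ H, h • A = A}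
  add_mem' := by
    rintro A B ⟨hA, hA'⟩ ⟨hB, hB'⟩
    refine ⟨hA.add hB, fun h hh => ?_⟩
    rw [smul_add, hA' h hh, hB' h hh]

/-! Let 𝔤 be the Lie algebra of `G`. Some `y ∈ 𝔞` satisfies 𝔤y = 𝔞ᗮ, for otherwise `G𝔞` has
dimension less than dim V, against (A) (`IsCartanSubspace.exists_lieOrbit_eq`). With the symmetry
⟨ξy, ηx⟩ = ⟨ηy, ξx⟩ on 𝔞, such a `y` lets the isotropy group of any `x ∈ 𝔞` carry each vector normal
to `Gx` into 𝔞 (`IsCartanSubspace.exists_isotropy_smul_mem`).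

This has two consequences. Points of 𝔞 in one `G`-orbit lie in one `W`-orbit. And π(Gu) ⊆ conv(Gu ∩
𝔞), a convexity theorem of Kostant type: for `x ∈ 𝔞`, the functional ⟨·, x⟩ attains its maximum over
`Gu` at a point of 𝔞.

Hence π(A) = A ∩ 𝔞 for invariant convex `A`, and linearity of π makes A ↦ A ∩ 𝔞 additive.
Injectivity follows from (A). The inverse is C ↦ GC, which is convex by the convexity theorem. -/

open Filter Topology

/-! ### Lie algebras of closed linear groups -/

section ExpSubgroup

variable {𝔸 : Type*} [NormedRing 𝔸] [NormedAlgebra ℝ 𝔸] [CompleteSpace 𝔸]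

theorem continuous_exp_real : Continuous (NormedSpace.exp : 𝔸 → 𝔸) :=
  let _ := NormedAlgebra.restrictScalars ℚ ℝ 𝔸
  NormedSpace.exp_continuous

theorem exp_mul_exp_neg (x : 𝔸) : NormedSpace.exp x * NormedSpace.exp (-x) = 1 := by
  let _ := NormedAlgebra.restrictScalars ℚ ℝ 𝔸
  rw [← NormedSpace.exp_add_of_commute (Commute.neg_right (Commute.refl x)), add_neg_cancel,
    NormedSpace.exp_zero]

theorem exp_neg_mem {G : Subgroup 𝔸ˣ} {x : 𝔸}
    (hx : NormedSpace.exp x ∈ Units.val '' (G : Set 𝔸ˣ)) :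
    NormedSpace.exp (-x) ∈ Units.val '' (G : Set 𝔸ˣ) := by
  obtain ⟨g, hg, hgx⟩ := hx
  refine ⟨g⁻¹, G.inv_mem hg, ?_⟩
  rw [Units.inv_eq_of_mul_eq_one_right (by rw [hgx, exp_mul_exp_neg])]

theorem exp_nsmul_mem {G : Subgroup 𝔸ˣ} {x : 𝔸}
    (hx : NormedSpace.exp x ∈ Units.val '' (G : Set 𝔸ˣ)) (k : ℕ) :
    NormedSpace.exp (k • x) ∈ Units.val '' (G : Set 𝔸ˣ) := by
  let _ := NormedAlgebra.restrictScalars ℚ ℝ 𝔸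
  obtain ⟨g, hg, hgx⟩ := hx
  exact ⟨g ^ k, G.pow_mem hg k, by rw [NormedSpace.exp_nsmul, ← hgx, Units.val_pow_eq_pow_val]⟩

theorem exp_zsmul_mem {G : Subgroup 𝔸ˣ} {x : 𝔸}
    (hx : NormedSpace.exp x ∈ Units.val '' (G : Set 𝔸ˣ)) (k : ℤ) :
    NormedSpace.exp (k • x) ∈ Units.val '' (G : Set 𝔸ˣ) := by
  obtain ⟨n, rfl | rfl⟩ := k.eq_nat_or_neg
  · simpa using exp_nsmul_mem hx n
  · simpa using exp_neg_mem (exp_nsmul_mem hx n)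

/-- If `exp (s i)` lies in a closed subgroup, `τ i → 0⁺` and `s i / τ i → ξ`, then the
one-parameter group generated by `ξ` lies in the subgroup. -/
theorem exp_smul_mem_of_tendsto {G : Subgroup 𝔸ˣ} (hG : IsClosed (Units.val '' (G : Set 𝔸ˣ)))
    {ι : Type*} {l : Filter ι} [l.NeBot] {s : ι → 𝔸} {τ : ι → ℝ} {ξ : 𝔸}
    (hs : ∀ᶠ i in l, NormedSpace.exp (s i) ∈ Units.val '' (G : Set 𝔸ˣ))
    (hτ : Tendsto τ l (𝓝[>] 0)) (hlim : Tendsto (fun i => (τ i)⁻¹ • s i) l (𝓝 ξ)) (t : ℝ) :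
    NormedSpace.exp (t • ξ) ∈ Units.val '' (G : Set 𝔸ˣ) := by
  have hτ0 : Tendsto τ l (𝓝 0) := hτ.mono_right nhdsWithin_le_nhds
  have hpos : ∀ᶠ i in l, 0 < τ i := hτ.eventually self_mem_nhdsWithin
  -- Integer multiples of `s i` exponentiate into `G`; the multiple ⌊t / τ i⌋ is chosen because ⌊t /
  -- τ i⌋ τ i differs from `t` by at most `τ i`.
  have hk : Tendsto (fun i => (⌊t / τ i⌋ : ℝ) * τ i) l (𝓝 t) := by
    rw [tendsto_iff_dist_tendsto_zero]
    refine squeeze_zero' (Eventually.of_forall fun _ => dist_nonneg) ?_ hτ0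
    filter_upwards [hpos] with i hi
    have h1 := Int.floor_le (t / τ i)
    have h2 := (Int.lt_floor_add_one (t / τ i)).le
    rw [le_div_iff₀ hi] at h1
    rw [div_le_iff₀ hi, add_mul, one_mul] at h2
    rw [Real.dist_eq, abs_le]
    constructor <;> linarith
  have hlim' : Tendsto (fun i => NormedSpace.exp (⌊t / τ i⌋ • s i)) l
      (𝓝 (NormedSpace.exp (t • ξ))) := by
    refine (continuous_exp_real.tendsto _).comp ((hk.smul hlim).congr' ?_)
    filter_upwards [hpos] with i hi
    rw [smul_smul, mul_assoc, mul_inv_cancel₀ hi.ne', mul_one, Int.cast_smul_eq_zsmul]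
  exact hG.mem_of_tendsto hlim' (hs.mono fun i hi => exp_zsmul_mem hi _)

/-- The velocity at the identity of a curve in a closed subgroup generates a one-parameter group
in the subgroup. -/
theorem exp_smul_mem_of_hasDerivAt {G : Subgroup 𝔸ˣ}
    (hG : IsClosed (Units.val '' (G : Set 𝔸ˣ))) {g : ℝ → 𝔸} {ξ : 𝔸} (hg : HasDerivAt g ξ 0)
    (hg0 : g 0 = 1) (hgG : ∀ t, g t ∈ Units.val '' (G : Set 𝔸ˣ)) (t : ℝ) :
    NormedSpace.exp (t • ξ) ∈ Units.val '' (G : Set 𝔸ˣ) := by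
  have hexp : HasStrictFDerivAt (NormedSpace.exp : 𝔸 → 𝔸)
      ((ContinuousLinearEquiv.refl ℝ 𝔸 : 𝔸 ≃L[ℝ] 𝔸) : 𝔸 →L[ℝ] 𝔸) 0 :=
    hasStrictFDerivAt_exp_zero (𝕂 := ℝ)
  set log := hexp.localInverse _ _ _
  have hlog : HasFDerivAt log (ContinuousLinearMap.id ℝ 𝔸) (g 0) := by
    have := hexp.to_localInverse.hasFDerivAt
    rw [NormedSpace.exp_zero] at this
    rw [hg0]
    exact this
  have hlog0 : log (g 0) = 0 := by
    have := hexp.localInverse_apply_image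
    rwa [NormedSpace.exp_zero, ← hg0] at this
  -- The local logarithm has derivative the identity at 1, so `log (g r) / r` tends to ξ.
  have hs : HasDerivAt (log ∘ g) ξ 0 := by simpa using hlog.comp_hasDerivAt 0 hg
  have hright : ∀ᶠ y in 𝓝 (g 0), NormedSpace.exp (log y) = y := by
    have := hexp.eventually_right_inverse
    rwa [NormedSpace.exp_zero, ← hg0] at this
  refine exp_smul_mem_of_tendsto hG (l := 𝓝[>] 0) (s := log ∘ g) (τ := id) ?_ tendsto_id ?_ t
  · filter_upwards [nhdsWithin_le_nhds (hg.continuousAt.eventually hright)] with r hr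
    rw [Function.comp_apply, hr]
    exact hgG r
  · have := (hasDerivAt_iff_tendsto_slope.1 hs).mono_left
      (nhdsWithin_mono 0 fun x (hx : 0 < x) => hx.ne')
    refine this.congr fun r => ?_
    simp [slope_def_module, hlog0]

theorem hasDerivAt_exp_smul_zero (ξ : 𝔸) :
    HasDerivAt (fun t : ℝ => NormedSpace.exp (t • ξ)) ξ 0 := by
  simpa using hasDerivAt_exp_smul_const (𝕂 := ℝ) ξ (0 : ℝ)

/-- The Lie algebra of a closed subgroup of the unit group of a Banach algebra. -/
def subgroupLie (G : Subgroup 𝔸ˣ) (hG : IsClosed (Units.val '' (G : Set 𝔸ˣ))) :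
    Submodule ℝ 𝔸 where
  carrier := {ξ | ∀ t : ℝ, NormedSpace.exp (t • ξ) ∈ Units.val '' (G : Set 𝔸ˣ)}
  zero_mem' t := ⟨1, G.one_mem, by simp [NormedSpace.exp_zero]⟩
  smul_mem' c ξ hξ t := by
    rw [smul_smul]
    exact hξ _
  add_mem' {ξ η} hξ hη := by
    refine exp_smul_mem_of_hasDerivAt hG
      (g := fun t : ℝ => NormedSpace.exp (t • ξ) * NormedSpace.exp (t • η)) ?_ ?_ ?_
    · refine ((hasDerivAt_exp_smul_zero ξ).mul (hasDerivAt_exp_smul_zero η)).congr_deriv ?_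
      simp [NormedSpace.exp_zero]
    · simp [NormedSpace.exp_zero]
    · intro t
      obtain ⟨g, hg, hgt⟩ := hξ t
      obtain ⟨h, hh, hht⟩ := hη t
      exact ⟨g * h, G.mul_mem hg hh, by simp [hgt, hht]⟩

theorem mem_subgroupLie {G : Subgroup 𝔸ˣ} {hG : IsClosed (Units.val '' (G : Set 𝔸ˣ))} {ξ : 𝔸} :
    ξ ∈ subgroupLie G hG ↔
      ∀ t : ℝ, NormedSpace.exp (t • ξ) ∈ Units.val '' (G : Set 𝔸ˣ) := Iff.rfl

theorem conj_mem_subgroupLie {G : Subgroup 𝔸ˣ} {hG : IsClosed (Units.val '' (G : Set 𝔸ˣ))}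
    {g : 𝔸ˣ} (hg : g ∈ G) {ξ : 𝔸} (hξ : ξ ∈ subgroupLie G hG) :
    (g : 𝔸) * ξ * ((g⁻¹ : 𝔸ˣ) : 𝔸) ∈ subgroupLie G hG := by
  let _ := NormedAlgebra.restrictScalars ℚ ℝ 𝔸
  intro t
  obtain ⟨h, hh, hht⟩ := hξ t
  refine ⟨g * h * g⁻¹, G.mul_mem (G.mul_mem hg hh) (G.inv_mem hg), ?_⟩
  rw [← smul_mul_assoc, ← mul_smul_comm, NormedSpace.exp_units_conj, ← hht]
  simp

/-- A complement of the Lie algebra of a closed subgroup contains no small logarithms of elements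
of the subgroup. -/
theorem eventually_eq_zero_of_exp_mem [FiniteDimensional ℝ 𝔸] {G : Subgroup 𝔸ˣ}
    (hG : IsClosed (Units.val '' (G : Set 𝔸ˣ))) {C : Submodule ℝ 𝔸}
    (hC : Disjoint (subgroupLie G hG) C) :
    ∀ᶠ c : C in 𝓝 0, NormedSpace.exp (c : 𝔸) ∈ Units.val '' (G : Set 𝔸ˣ) → c = 0 := by
  by_contra hne
  rw [not_eventually, frequently_iff_seq_forall] at hne
  obtain ⟨c, hc, hcG⟩ := hne
  simp only [Classical.not_imp] at hcG
  -- A limit direction of the offending logarithms is a unit vector of `C` that lies in the Lie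
  -- algebra, which is impossible.
  have hsph : ∀ n, ‖c n‖⁻¹ • c n ∈ Metric.sphere (0 : C) 1 := fun n => by
    simp [norm_smul, (hcG n).2]
  obtain ⟨ξ, hξ, φ, hφ, hlim⟩ := (isCompact_sphere (0 : C) 1).tendsto_subseq hsph
  have hmem : (ξ : 𝔸) ∈ subgroupLie G hG := by
    refine exp_smul_mem_of_tendsto hG (l := atTop) (s := fun n => (c (φ n) : 𝔸))
      (τ := fun n => ‖c (φ n)‖) (Eventually.of_forall fun n => (hcG _).1) ?_ ?_
    · refine tendsto_nhdsWithin_iff.2 ⟨?_, Eventually.of_forall fun n => norm_pos_iff.2 (hcG _).2⟩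
      simpa using (hc.comp hφ.tendsto_atTop).norm
    · exact (continuous_subtype_val.tendsto ξ).comp hlim
  have h0 : (ξ : 𝔸) = 0 := (Submodule.disjoint_def.1 hC) _ hmem ξ.2
  have h1 : ξ = 0 := Subtype.ext h0
  simp [h1] at hξ

/-- A closed subgroup with Lie algebra `M ⊔ Z` is covered near the identity by
`exp M * exp Z`. -/
theorem eventually_eq_exp_mul_exp [FiniteDimensional ℝ 𝔸] {G : Subgroup 𝔸ˣ}
    (hG : IsClosed (Units.val '' (G : Set 𝔸ˣ))) {M Z : Submodule ℝ 𝔸}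
    (hMZ : M ⊔ Z = subgroupLie G hG) :
    ∀ᶠ x in 𝓝 (1 : 𝔸), x ∈ Units.val '' (G : Set 𝔸ˣ) →
      ∃ m ∈ M, ∃ z ∈ Z, x = NormedSpace.exp m * NormedSpace.exp z := by
  obtain ⟨C, hC⟩ := Submodule.exists_isCompl (subgroupLie G hG)
  let Φ : M × Z × C → 𝔸 := fun p =>
    NormedSpace.exp (p.1 : 𝔸) * NormedSpace.exp (p.2.1 : 𝔸) * NormedSpace.exp (p.2.2 : 𝔸)
  let pM : M × Z × C →L[ℝ] 𝔸 := M.subtypeL.comp (ContinuousLinearMap.fst ℝ M (Z × C))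
  let pZ : M × Z × C →L[ℝ] 𝔸 := Z.subtypeL.comp
    ((ContinuousLinearMap.fst ℝ Z C).comp (ContinuousLinearMap.snd ℝ M (Z × C)))
  let pC : M × Z × C →L[ℝ] 𝔸 := C.subtypeL.comp
    ((ContinuousLinearMap.snd ℝ Z C).comp (ContinuousLinearMap.snd ℝ M (Z × C)))
  have key : ∀ p : M × Z × C →L[ℝ] 𝔸,
      HasStrictFDerivAt (fun q => NormedSpace.exp (p q)) p 0 := fun p => by
    have h : HasStrictFDerivAt (NormedSpace.exp : 𝔸 → 𝔸) (1 : 𝔸 →L[ℝ] 𝔸) (p 0) := by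
      rw [map_zero]
      exact hasStrictFDerivAt_exp_zero
    exact h.comp 0 p.hasStrictFDerivAt
  -- The derivative at 0 is (m, z, c) ↦ m + z + c. Surjectivity is enough to cover a neighbourhood
  -- of 1.
  have hΦ : HasStrictFDerivAt Φ (pM + pZ + pC) 0 := by
    have h := ((key pM).mul' (key pZ)).mul' (key pC)
    refine h.congr_fderiv (ContinuousLinearMap.ext fun p => ?_)
    simp only [map_zero, NormedSpace.exp_zero, Pi.mul_apply, mul_one, one_smul,
      MulOpposite.op_one, add_apply]
    abel
  have hsurj : (pM + pZ + pC).range = ⊤ := by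
    rw [eq_top_iff]
    intro x _
    have hx : x ∈ (M ⊔ Z) ⊔ C := by
      rw [hMZ, hC.sup_eq_top]
      trivial
    obtain ⟨y, hy, c, hc, rfl⟩ := Submodule.mem_sup.1 hx
    obtain ⟨m, hm, z, hz, rfl⟩ := Submodule.mem_sup.1 hy
    exact ⟨(⟨m, hm⟩, ⟨z, hz⟩, ⟨c, hc⟩), rfl⟩
  have hmap := hΦ.map_nhds_eq_of_surj hsurj
  have hΦ0 : Φ 0 = 1 := by simp [Φ, NormedSpace.exp_zero]
  rw [hΦ0] at hmap
  have hsmall : ∀ᶠ p : M × Z × C in 𝓝 0,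
      NormedSpace.exp (p.2.2 : 𝔸) ∈ Units.val '' (G : Set 𝔸ˣ) → p.2.2 = 0 :=
    (continuous_snd.snd.tendsto' (0 : M × Z × C) (0 : C) rfl).eventually
      (eventually_eq_zero_of_exp_mem hG hC.disjoint)
  rw [← hmap, eventually_map]
  filter_upwards [hsmall] with p hp hpG
  have hexp : ∀ ξ ∈ subgroupLie G hG, NormedSpace.exp ξ ∈ Units.val '' (G : Set 𝔸ˣ) :=
    fun ξ hξ => by simpa using hξ 1
  obtain ⟨g, hg, hgp⟩ := hpG
  obtain ⟨a, ha, hap⟩ := hexp _ (hMZ ▸ Submodule.mem_sup_left p.1.2 : (p.1 : 𝔸) ∈ _)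
  obtain ⟨b, hb, hbp⟩ := hexp _ (hMZ ▸ Submodule.mem_sup_right p.2.1.2 : (p.2.1 : 𝔸) ∈ _)
  -- The first two factors lie in `G`, hence so does the third, whose logarithm in `C` is small.
  have hc : p.2.2 = 0 := by
    refine hp ⟨(a * b)⁻¹ * g, G.mul_mem (G.inv_mem (G.mul_mem ha hb)) hg, ?_⟩
    rw [Units.val_mul, hgp, Units.inv_mul_eq_iff_eq_mul, Units.val_mul, hap, hbp]
  exact ⟨p.1, p.1.2, p.2.1, p.2.1.2, by simp [Φ, hc, NormedSpace.exp_zero]⟩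

end ExpSubgroup

theorem contDiff_submodule_coe {E : Type*} [NormedAddCommGroup E] [NormedSpace ℝ E]
    (M : Submodule ℝ E) : ContDiff ℝ 1 fun x : M => (x : E) :=
  M.subtypeL.contDiff

/-! ### Infinitesimal action on a Cartan subspace and regular points -/

section PolarLie

variable {V : Type*} [NormedAddCommGroup V] [InnerProductSpace ℝ V]
  {G : Subgroup (V →L[ℝ] V)ˣ} {hG : IsClosed (Units.val '' (G : Set (V →L[ℝ] V)ˣ))}
  {𝔞 : Submodule ℝ V}

theorem inner_smul_smul_of_norm_smul {g : (V →L[ℝ] V)ˣ} (hg : ∀ v : V, ‖g • v‖ = ‖v‖) (u v : V) :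
    inner ℝ (g • u) (g • v) = inner ℝ u v :=
  LinearIsometry.inner_map_map
    (⟨((g : V →L[ℝ] V) : V →ₗ[ℝ] V), hg⟩ : V →ₗᵢ[ℝ] V) u v

theorem inner_smul_left_of_norm_smul {g : (V →L[ℝ] V)ˣ} (hg : ∀ v : V, ‖g • v‖ = ‖v‖) (u v : V) :
    inner ℝ (g • u) v = inner ℝ u (g⁻¹ • v) := by
  rw [← inner_smul_smul_of_norm_smul hg u, smul_inv_smul]

variable [FiniteDimensional ℝ V]

theorem exp_smul_apply_mem_orbit {ξ : V →L[ℝ] V} (hξ : ξ ∈ subgroupLie G hG) (t : ℝ) (u : V) :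
    NormedSpace.exp (t • ξ) u ∈ MulAction.orbit G u := by
  obtain ⟨g, hg, hgt⟩ := hξ t
  exact ⟨⟨g, hg⟩, by rw [← hgt]; rfl⟩

theorem hasDerivAt_exp_smul_apply (ξ : V →L[ℝ] V) (u : V) :
    HasDerivAt (fun t : ℝ => NormedSpace.exp (t • ξ) u) (ξ u) 0 := by
  simpa using (hasDerivAt_exp_smul_zero ξ).clm_apply (hasDerivAt_const (0 : ℝ) u)

theorem apply_mem_orbitTangentSpace {ξ : V →L[ℝ] V} (hξ : ξ ∈ subgroupLie G hG) (u : V) :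
    ξ u ∈ orbitTangentSpace G u := by
  refine Submodule.subset_span ?_
  have hslope := (hasDerivAt_iff_tendsto_slope.1 (hasDerivAt_exp_smul_apply ξ u))
  refine mem_tangentConeAt_of_seq (𝓝[≠] (0 : ℝ)) (fun t => t⁻¹)
    (fun t => NormedSpace.exp (t • ξ) u - u) ?_ ?_ ?_
  · have h := (hasDerivAt_exp_smul_apply ξ u).continuousAt.tendsto.mono_left
      (nhdsWithin_le_nhds (s := {0}ᶜ))
    simpa [NormedSpace.exp_zero] using h.sub_const u
  · exact Eventually.of_forall fun t => by
      simpa using exp_smul_apply_mem_orbit hξ t u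
  · refine hslope.congr fun t => ?_
    simp [slope_def_module, NormedSpace.exp_zero]

theorem IsCartanSubspace.inner_lie_apply (h : IsCartanSubspace G 𝔞) {ξ : V →L[ℝ] V}
    (hξ : ξ ∈ subgroupLie G hG) {u a : V} (hu : u ∈ 𝔞) (ha : a ∈ 𝔞) : inner ℝ (ξ u) a = 0 :=
  Submodule.isOrtho_iff_inner_eq.1 (h.tangent_orthogonal u hu) _
    (apply_mem_orbitTangentSpace hξ u) _ ha

theorem inner_lie_apply_left (horth : ∀ g ∈ G, ∀ v : V, ‖g • v‖ = ‖v‖) {ξ : V →L[ℝ] V}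
    (hξ : ξ ∈ subgroupLie G hG) (u v : V) : inner ℝ (ξ u) v = -inner ℝ u (ξ v) := by
  have h := (hasDerivAt_exp_smul_apply ξ u).inner ℝ (hasDerivAt_exp_smul_apply ξ v)
  have hconst : (fun t : ℝ => inner ℝ (NormedSpace.exp (t • ξ) u) (NormedSpace.exp (t • ξ) v))
      = fun _ => inner ℝ u v := by
    funext t
    obtain ⟨g, hg, hgt⟩ := hξ t
    rw [← hgt]
    exact inner_smul_smul_of_norm_smul (horth g hg) u v
  rw [hconst] at h
  have := h.unique (hasDerivAt_const _ _)
  simp [NormedSpace.exp_zero] at this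
  linarith

/-- On a Cartan subspace the infinitesimal action is symmetric. -/
theorem IsCartanSubspace.inner_lie_apply_lie_apply (h : IsCartanSubspace G 𝔞)
    (horth : ∀ g ∈ G, ∀ v : V, ‖g • v‖ = ‖v‖) {ξ η : V →L[ℝ] V} (hξ : ξ ∈ subgroupLie G hG)
    (hη : η ∈ subgroupLie G hG) {x y : V} (hx : x ∈ 𝔞) (hy : y ∈ 𝔞) :
    inner ℝ (ξ y) (η x) = inner ℝ (η y) (ξ x) := by
  -- With g = exp(-tξ), the value is ⟨y, (g⁻¹ηg)x⟩, which vanishes by (B) because g⁻¹ηg is again in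
  -- the Lie algebra. The symmetry is the derivative at 0, by skewness of η.
  have hconst : (fun t : ℝ => inner ℝ (NormedSpace.exp (t • -ξ) y)
      (η (NormedSpace.exp (t • -ξ) x))) = fun _ => 0 := by
    funext t
    obtain ⟨g, hg, hgt⟩ := Submodule.neg_mem _ hξ t
    rw [← hgt, real_inner_comm]
    have := inner_smul_left_of_norm_smul (horth _ (G.inv_mem hg)) (η (g • x)) y
    rw [inv_inv] at this
    have hc := h.inner_lie_apply (conj_mem_subgroupLie (hG := hG) (G.inv_mem hg) hη) hx hy
    rw [inv_inv] at hc
    exact this.symm.trans hc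
  have hd := (hasDerivAt_exp_smul_apply (-ξ) y).inner ℝ
    ((hasDerivAt_const (0 : ℝ) η).clm_apply (hasDerivAt_exp_smul_apply (-ξ) x))
  rw [hconst] at hd
  have h0 := hd.unique (hasDerivAt_const _ _)
  simp [NormedSpace.exp_zero] at h0
  have h1 := inner_lie_apply_left horth hη y (ξ x)
  linarith

/-- The tangent space `𝔤 v` of the orbit of `v`, with `𝔤` the Lie algebra of `G`. -/
noncomputable def lieOrbit (G : Subgroup (V →L[ℝ] V)ˣ) (hG : IsClosed (Units.val '' (G : Set (V →L[ℝ] V)ˣ)))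
    (v : V) : Submodule ℝ V :=
  (subgroupLie G hG).map (ContinuousLinearMap.apply ℝ V v : (V →L[ℝ] V) →ₗ[ℝ] V)

theorem mem_lieOrbit {v w : V} : w ∈ lieOrbit G hG v ↔ ∃ ξ ∈ subgroupLie G hG, ξ v = w :=
  Iff.rfl

theorem IsCartanSubspace.lieOrbit_le (h : IsCartanSubspace G 𝔞) {u : V} (hu : u ∈ 𝔞) :
    lieOrbit G hG u ≤ 𝔞ᗮ := by
  rintro _ ⟨ξ, hξ, rfl⟩
  exact (Submodule.mem_orthogonal' _ _).2 fun a ha => h.inner_lie_apply hξ hu ha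

/-- If ξa ≠ 0, symmetry keeps ξa out of 𝔤y: from ηy = ξa follows |ξa|² = ⟨ξy, ηa⟩ = 0. As ξ(y + ta)
= tξa, the orbit of y + ta for small t ≠ 0 has tangent space of larger dimension than 𝔤y, against
maximality. -/
theorem IsCartanSubspace.lie_apply_eq_zero (h : IsCartanSubspace G 𝔞)
    (horth : ∀ g ∈ G, ∀ v : V, ‖g • v‖ = ‖v‖) {y : V} (hy : y ∈ 𝔞)
    (hmax : ∀ x ∈ 𝔞, Module.finrank ℝ (lieOrbit G hG x) ≤ Module.finrank ℝ (lieOrbit G hG y))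
    {ξ : V →L[ℝ] V} (hξ : ξ ∈ subgroupLie G hG) (hξy : ξ y = 0) {a : V} (ha : a ∈ 𝔞) :
    ξ a = 0 := by
  by_contra hne
  have hperp : ξ a ∉ lieOrbit G hG y := by
    rintro ⟨η, hη, hηy⟩
    replace hηy : η y = ξ a := hηy
    have := h.inner_lie_apply_lie_apply horth hξ hη ha hy
    rw [hξy, inner_zero_left, hηy, real_inner_self_eq_norm_sq] at this
    exact hne (norm_eq_zero.1 (by simpa using this.symm))
  let b := Module.finBasis ℝ (lieOrbit G hG y)
  choose η hη hηy using fun i => mem_lieOrbit.1 (b i).2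
  let f : ℝ → Fin (Module.finrank ℝ (lieOrbit G hG y) + 1) → V := fun t =>
    Fin.cons (ξ a) fun i => η i (y + t • a)
  have hf : Continuous f := by
    refine continuous_pi fun i => ?_
    refine Fin.cases ?_ (fun i => ?_) i
    · exact continuous_const
    · exact (η i).continuous.comp (by fun_prop)
  have hli : LinearIndependent ℝ (f 0) := by
    have e : (fun i => η i (y + (0 : ℝ) • a)) = fun i => ((b i : lieOrbit G hG y) : V) := by
      funext i
      simp [hηy]
    simp only [f]
    rw [e, linearIndependent_finCons]
    refine ⟨b.linearIndependent.map' (lieOrbit G hG y).subtype (Submodule.ker_subtype _), ?_⟩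
    intro hmem
    refine hperp (Submodule.span_le.2 ?_ hmem)
    rintro _ ⟨i, rfl⟩
    exact (b i).2
  have hev : ∀ᶠ t in 𝓝[≠] (0 : ℝ), LinearIndependent ℝ (f t) :=
    nhdsWithin_le_nhds ((hf.tendsto 0).eventually
      (isOpen_setOfPred_linearIndependent.mem_nhds hli))
  obtain ⟨t, ht, ht0⟩ := (hev.and self_mem_nhdsWithin).exists
  have hspan : Submodule.span ℝ (Set.range (f t)) ≤ lieOrbit G hG (y + t • a) := by
    rw [Submodule.span_le]
    rintro _ ⟨i, rfl⟩
    refine Fin.cases ?_ (fun i => ?_) i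
    · refine ⟨t⁻¹ • ξ, Submodule.smul_mem _ _ hξ, ?_⟩
      have ht0' : t ≠ 0 := ht0
      simp [f, hξy, ht0']
    · exact ⟨η i, hη i, rfl⟩
  have h1 := Submodule.finrank_mono hspan
  rw [finrank_span_eq_card ht, Fintype.card_fin] at h1
  have h2 := hmax _ (𝔞.add_mem hy (𝔞.smul_mem t ha))
  omega

theorem contDiff_exp_apply (M : Submodule ℝ (V →L[ℝ] V)) (𝔞 : Submodule ℝ V) (g : V →L[ℝ] V) :
    ContDiff ℝ 1 fun p : M × 𝔞 => g (NormedSpace.exp (p.1 : V →L[ℝ] V) (p.2 : V)) := by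
  have hexp : ContDiff ℝ 1 (NormedSpace.exp : (V →L[ℝ] V) → V →L[ℝ] V) :=
    contDiff_iff_contDiffAt.2 fun x => (NormedSpace.exp_analytic (𝕂 := ℝ) x).contDiffAt
  refine g.contDiff.comp (ContDiff.clm_apply (hexp.comp ?_) ?_)
  · exact (contDiff_submodule_coe M).comp contDiff_fst
  · exact (contDiff_submodule_coe 𝔞).comp contDiff_snd

theorem exp_apply_of_apply_eq_zero {ξ : V →L[ℝ] V} {a : V} (h : ξ a = 0) :
    NormedSpace.exp ξ a = a := by
  have hs := (NormedSpace.exp_series_hasSum_exp' (𝕂 := ℝ) ξ).mapL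
    (ContinuousLinearMap.apply ℝ V a)
  refine hs.unique ?_
  convert hasSum_single 0 fun n hn => ?_ using 1
  · simp
  · obtain ⟨n, rfl⟩ := Nat.exists_eq_succ_of_ne_zero hn
    simp [pow_succ, h]

/-- If the linear subspace `𝔞` is fixed by `Z` and `dim M + dim 𝔞 < dim V`, where `M ⊔ Z` is the
Lie algebra of a compact group, then some orbit of the group misses `𝔞`. -/
theorem exists_forall_smul_notMem (hcompact : IsCompact (G : Set (V →L[ℝ] V)ˣ))
    {M Z : Submodule ℝ (V →L[ℝ] V)} (hMZ : M ⊔ Z = subgroupLie G hG)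
    (hZ : ∀ ξ ∈ Z, ∀ a ∈ 𝔞, ξ a = 0)
    (hdim : Module.finrank ℝ M + Module.finrank ℝ 𝔞 < Module.finrank ℝ V) :
    ∃ v : V, ∀ g ∈ G, ∀ a ∈ 𝔞, g • a ≠ v := by
  by_contra! hcov
  -- Since exp Z fixes 𝔞, finitely many of these C¹ images of M × 𝔞 cover `G𝔞`. Their Hausdorff
  -- dimension is at most dim M + dim 𝔞.
  let R : (V →L[ℝ] V)ˣ → Set V := fun g =>
    Set.range fun p : M × 𝔞 => (g : V →L[ℝ] V) (NormedSpace.exp (p.1 : V →L[ℝ] V) (p.2 : V))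
  have hR : ∀ g, dimH (R g) ≤ (Module.finrank ℝ M + Module.finrank ℝ 𝔞 : ℕ) := fun g => by
    have := (contDiff_exp_apply M 𝔞 (g : V →L[ℝ] V)).dimH_range_le
    rwa [Module.finrank_prod] at this
  have hnhds : ∀ g ∈ (G : Set (V →L[ℝ] V)ˣ), {x : (V →L[ℝ] V)ˣ |
      ((g⁻¹ * x : (V →L[ℝ] V)ˣ) : V →L[ℝ] V) ∈ Units.val '' (G : Set (V →L[ℝ] V)ˣ) →
      ∃ m ∈ M, ∃ z ∈ Z, ((g⁻¹ * x : (V →L[ℝ] V)ˣ) : V →L[ℝ] V)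
        = NormedSpace.exp m * NormedSpace.exp z} ∈ 𝓝 g := fun g _ => by
    have hc : Tendsto (fun x : (V →L[ℝ] V)ˣ => ((g⁻¹ * x : (V →L[ℝ] V)ˣ) : V →L[ℝ] V))
        (𝓝 g) (𝓝 1) :=
      (Units.continuous_val.comp (continuous_const.mul continuous_id)).tendsto' _ _ (by simp)
    exact hc.eventually (eventually_eq_exp_mul_exp hG hMZ)
  obtain ⟨t, htG, ht⟩ := hcompact.elim_nhds_subcover _ hnhds
  have huniv : (Set.univ : Set V) ⊆ ⋃ g ∈ t, R g := by
    intro v _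
    obtain ⟨g, hg, a, ha, rfl⟩ := hcov v
    obtain ⟨k, hk, hgk⟩ := Set.mem_iUnion₂.1 (ht hg)
    obtain ⟨m, hm, z, hz, hmz⟩ := hgk ⟨k⁻¹ * g, G.mul_mem (G.inv_mem (htG k hk)) hg, rfl⟩
    refine Set.mem_iUnion₂.2 ⟨k, hk, (⟨m, hm⟩, ⟨a, ha⟩), ?_⟩
    have hma : (k⁻¹ * g) • a = NormedSpace.exp m a := by
      change ((k⁻¹ * g : (V →L[ℝ] V)ˣ) : V →L[ℝ] V) a = _
      rw [hmz, mul_apply_eq_comp, exp_apply_of_apply_eq_zero (hZ z hz a ha)]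
    rw [mul_smul, inv_smul_eq_iff] at hma
    exact hma.symm
  have h1 : dimH (Set.univ : Set V) ≤ dimH (⋃ g ∈ (t : Set (V →L[ℝ] V)ˣ), R g) :=
    dimH_mono (by simpa using huniv)
  rw [Real.dimH_univ_eq_finrank, dimH_bUnion t.countable_toSet] at h1
  have h2 := h1.trans (iSup₂_le fun g _ => hR g)
  exact absurd (Nat.cast_le.1 h2) (not_le.2 hdim)

/-- A Cartan subspace contains a point whose orbit has the orthogonal complement of the Cartan
subspace as tangent space. -/
theorem IsCartanSubspace.exists_lieOrbit_eq (h : IsCartanSubspace G 𝔞)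
    (hcompact : IsCompact (G : Set (V →L[ℝ] V)ˣ)) (horth : ∀ g ∈ G, ∀ v : V, ‖g • v‖ = ‖v‖)
    (hG : IsClosed (Units.val '' (G : Set (V →L[ℝ] V)ˣ))) :
    ∃ y ∈ 𝔞, lieOrbit G hG y = 𝔞ᗮ := by
  -- Minimal codimension of 𝔤x is maximal orbit dimension.
  let y : 𝔞 := Function.argmin
    fun x : 𝔞 => Module.finrank ℝ V - Module.finrank ℝ (lieOrbit G hG x)
  have hmax : ∀ x ∈ 𝔞,
      Module.finrank ℝ (lieOrbit G hG x) ≤ Module.finrank ℝ (lieOrbit G hG y) := by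
    intro x hx
    have h1 := Function.argmin_le
      (fun x : 𝔞 => Module.finrank ℝ V - Module.finrank ℝ (lieOrbit G hG x)) ⟨x, hx⟩
    have h2 := (lieOrbit G hG x).finrank_le
    have h3 := (lieOrbit G hG y).finrank_le
    simp only at h1
    change _ - Module.finrank ℝ (lieOrbit G hG y) ≤ _ at h1
    omega
  refine ⟨y, y.2, ?_⟩
  by_contra hne
  let ev : (V →L[ℝ] V) →ₗ[ℝ] V := ContinuousLinearMap.apply ℝ V (y : V)
  -- By the modular law, intersecting 𝔤 with `K` gives a complement of the isotropy algebra inside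
  -- 𝔤; evaluation at `y` is injective on it.
  obtain ⟨K, hK⟩ := (subgroupLie G hG ⊓ LinearMap.ker ev).exists_isCompl
  have hMZ : subgroupLie G hG ⊓ K ⊔ subgroupLie G hG ⊓ LinearMap.ker ev = subgroupLie G hG := by
    rw [sup_comm, inf_comm (subgroupLie G hG) K, ← sup_inf_assoc_of_le K inf_le_left, hK.sup_eq_top,
      top_inf_eq]
  have hM : Module.finrank ℝ (subgroupLie G hG ⊓ K : Submodule ℝ (V →L[ℝ] V))
      ≤ Module.finrank ℝ (lieOrbit G hG y) := by
    let L : (subgroupLie G hG ⊓ K : Submodule ℝ (V →L[ℝ] V)) →ₗ[ℝ] lieOrbit G hG y :=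
      (ev.domRestrict _).codRestrict _ fun m => ⟨m, m.2.1, rfl⟩
    refine LinearMap.finrank_le_finrank_of_injective (f := L) ?_
    rw [← LinearMap.ker_eq_bot, LinearMap.ker_eq_bot']
    intro m hm
    exact Subtype.ext ((Submodule.disjoint_def.1 hK.disjoint) _
      ⟨m.2.1, congrArg Subtype.val hm⟩ m.2.2)
  have hlt := Submodule.finrank_lt_finrank_of_lt (lt_of_le_of_ne (h.lieOrbit_le y.2) hne)
  have hsum := 𝔞.finrank_add_finrank_orthogonal
  obtain ⟨v, hv⟩ := exists_forall_smul_notMem hcompact hMZ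
    (fun ξ hξ a ha => h.lie_apply_eq_zero horth y.2 hmax hξ.1 hξ.2 ha) (by omega)
  obtain ⟨_, ⟨g, rfl⟩, hg⟩ := h.orbit_meets v
  exact hv g⁻¹ (G.inv_mem g.2) _ hg (inv_smul_smul g.1 v)

end PolarLie

/-- The convex hull of a compact set in a finite-dimensional space is compact. -/
theorem IsCompact.isCompact_convexHull_of_finiteDimensional {E : Type*} [NormedAddCommGroup E]
    [NormedSpace ℝ E] [FiniteDimensional ℝ E] {s : Set E} (hs : IsCompact s) :
    IsCompact (convexHull ℝ s) := by
  -- Carathéodory: dim E + 1 points suffice.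
  have heq : convexHull ℝ s = ⋃ n ∈ Set.Iic (Module.finrank ℝ E + 1),
      (fun p : (Fin n → ℝ) × (Fin n → E) => ∑ i, p.1 i • p.2 i) ''
        (stdSimplex ℝ (Fin n) ×ˢ Set.univ.pi fun _ => s) := by
    refine Set.Subset.antisymm (fun x hx => ?_) ?_
    · obtain ⟨ι, _, z, w, hz, hind, hw, hw1, rfl⟩ := eq_pos_convex_span_of_mem_convexHull hx
      let e := Fintype.equivFin ι
      refine Set.mem_iUnion₂.2 ⟨Fintype.card ι, hind.card_le_finrank_succ.trans
        (Nat.succ_le_succ (Submodule.finrank_le _)), (w ∘ e.symm, z ∘ e.symm), ⟨⟨?_, ?_⟩, ?_⟩, ?_⟩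
      · exact fun i => (hw _).le
      · rw [← hw1]
        exact e.symm.sum_comp w
      · exact fun i _ => hz ⟨_, rfl⟩
      · exact e.symm.sum_comp fun i => w i • z i
    · refine Set.iUnion₂_subset fun n _ => ?_
      rintro _ ⟨⟨w, z⟩, ⟨⟨hw, hw1⟩, hz⟩, rfl⟩
      exact (convex_convexHull ℝ s).sum_mem (fun i _ => hw i) hw1
        fun i _ => subset_convexHull ℝ s (hz i trivial)
  rw [heq]
  refine (Set.finite_Iic _).isCompact_biUnion fun n _ => ?_
  refine ((isCompact_stdSimplex ℝ (Fin n)).prod (isCompact_univ_pi fun _ => hs)).image ?_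
  fun_prop

/-! ### Weyl group conjugacy and the convexity theorem -/

section PolarConvexity

variable {V : Type*} [NormedAddCommGroup V] [InnerProductSpace ℝ V]
  {G : Subgroup (V →L[ℝ] V)ˣ} {hG : IsClosed (Units.val '' (G : Set (V →L[ℝ] V)ˣ))}
  {𝔞 : Submodule ℝ V}

theorem continuous_units_smul (v : V) : Continuous fun g : (V →L[ℝ] V)ˣ => g • v :=
  Units.continuous_val.clm_apply continuous_const

theorem exists_mem_weylGroup {n : (V →L[ℝ] V)ˣ} (hn : n ∈ G)
    (hn𝔞 : n • (𝔞 : Set V) = (𝔞 : Set V)) :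
    ∃ w ∈ weylGroup G 𝔞, ∀ x : 𝔞, ((w • x : 𝔞) : V) = n • (x : V) := by
  have h1 : ∀ x : 𝔞, n • (x : V) ∈ 𝔞 := fun x => by
    rw [← SetLike.mem_coe, ← hn𝔞]
    exact Set.smul_mem_smul_set x.2
  have h2 : ∀ x : 𝔞, n⁻¹ • (x : V) ∈ 𝔞 := fun x => by
    rw [← SetLike.mem_coe, ← Set.mem_smul_set_iff_inv_smul_mem, hn𝔞]
    exact x.2
  let w : (𝔞 →L[ℝ] 𝔞)ˣ :=
    { val := ((n : V →L[ℝ] V).comp 𝔞.subtypeL).codRestrict 𝔞 h1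
      inv := (((n⁻¹ : (V →L[ℝ] V)ˣ) : V →L[ℝ] V).comp 𝔞.subtypeL).codRestrict 𝔞 h2
      val_inv := ContinuousLinearMap.ext fun x => Subtype.ext (smul_inv_smul n (x : V))
      inv_val := ContinuousLinearMap.ext fun x => Subtype.ext (inv_smul_smul n (x : V)) }
  exact ⟨w, ⟨n, hn, hn𝔞, fun _ => rfl⟩, fun _ => rfl⟩

theorem smul_mem_iff_of_mem_invariantConvexSets {E : Type*} [NormedAddCommGroup E]
    [NormedSpace ℝ E] {H : Subgroup (E →L[ℝ] E)ˣ} {A : Set E} (hA : A ∈ invariantConvexSets H)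
    {g : (E →L[ℝ] E)ˣ} (hg : g ∈ H) {v : E} : g • v ∈ A ↔ v ∈ A := by
  nth_rw 1 [← hA.2 g hg]
  exact Set.smul_mem_smul_set_iff

theorem mem_invariantConvexSets_of_forall_smul_mem {E : Type*} [NormedAddCommGroup E]
    [NormedSpace ℝ E] {H : Subgroup (E →L[ℝ] E)ˣ} {A : Set E} (hA : Convex ℝ A)
    (h : ∀ g ∈ H, ∀ v ∈ A, g • v ∈ A) : A ∈ invariantConvexSets H := by
  refine ⟨hA, fun g hg => Set.Subset.antisymm ?_ fun v hv => ?_⟩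
  · rintro _ ⟨v, hv, rfl⟩
    exact h g hg v hv
  · rw [Set.mem_smul_set_iff_inv_smul_mem]
    exact h _ (H.inv_mem hg) v hv

theorem IsCartanSubspace.exists_smul_mem (h : IsCartanSubspace G 𝔞) (v : V) :
    ∃ g ∈ G, g • v ∈ 𝔞 := by
  obtain ⟨_, ⟨g, rfl⟩, hg⟩ := h.orbit_meets v
  exact ⟨g, g.2, hg⟩

theorem preimage_mem_invariantConvexSets {A : Set V} (hA : A ∈ invariantConvexSets G) :
    (Subtype.val ⁻¹' A : Set 𝔞) ∈ invariantConvexSets (weylGroup G 𝔞) := by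
  refine mem_invariantConvexSets_of_forall_smul_mem (hA.1.linear_preimage 𝔞.subtype) ?_
  rintro w ⟨g, hg, -, hw⟩ x hx
  rw [Set.mem_preimage, hw]
  exact (smul_mem_iff_of_mem_invariantConvexSets hA hg).2 hx

theorem IsCartanSubspace.subset_of_preimage_subset (h : IsCartanSubspace G 𝔞) {A B : Set V}
    (hA : A ∈ invariantConvexSets G) (hB : B ∈ invariantConvexSets G)
    (hAB : (Subtype.val ⁻¹' A : Set 𝔞) ⊆ Subtype.val ⁻¹' B) : A ⊆ B := by
  intro v hv
  obtain ⟨g, hg, hg𝔞⟩ := h.exists_smul_mem v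
  rw [← smul_mem_iff_of_mem_invariantConvexSets hB hg]
  exact hAB (a := ⟨g • v, hg𝔞⟩) ((smul_mem_iff_of_mem_invariantConvexSets hA hg).2 hv)

variable [FiniteDimensional ℝ V]

theorem inner_lie_apply_eq_zero_of_forall_le {ζ : V →L[ℝ] V} {w y : V}
    (h : ∀ t : ℝ, inner ℝ (NormedSpace.exp (t • ζ) w) y ≤ inner ℝ w y) :
    inner ℝ (ζ w) y = 0 := by
  have hd := (hasDerivAt_exp_smul_apply ζ w).inner ℝ (hasDerivAt_const (0 : ℝ) y)
  have hmax : IsLocalMax (fun t : ℝ => inner ℝ (NormedSpace.exp (t • ζ) w) y) 0 :=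
    Eventually.of_forall fun t => by simpa [NormedSpace.exp_zero] using h t
  simpa using hmax.hasDerivAt_eq_zero hd

theorem smul_mem_lieOrbit {g : (V →L[ℝ] V)ˣ} (hg : g ∈ G) {v w : V}
    (hw : w ∈ lieOrbit G hG v) : g • w ∈ lieOrbit G hG (g • v) := by
  obtain ⟨ξ, hξ, rfl⟩ := hw
  refine ⟨_, conj_mem_subgroupLie hg hξ, ?_⟩
  change g • ξ (g⁻¹ • g • v) = g • ξ v
  rw [inv_smul_smul]

/-- The isotropy group of `x` moves every vector normal to the orbit of `x` into `𝔞`. -/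
theorem IsCartanSubspace.exists_isotropy_smul_mem (h : IsCartanSubspace G 𝔞)
    (hcompact : IsCompact (G : Set (V →L[ℝ] V)ˣ)) (horth : ∀ g ∈ G, ∀ v : V, ‖g • v‖ = ‖v‖)
    {y : V} (hy : y ∈ 𝔞) (hreg : lieOrbit G hG y = 𝔞ᗮ) {x : V} (hx : x ∈ 𝔞) {v : V}
    (hv : ∀ p ∈ lieOrbit G hG x, inner ℝ p v = 0) : ∃ k ∈ G, k • x = x ∧ k • v ∈ 𝔞 := by
  have hK : IsCompact ((G : Set (V →L[ℝ] V)ˣ) ∩ {k | k • x = x}) :=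
    hcompact.inter_right (isClosed_eq (continuous_units_smul x) continuous_const)
  -- The maximiser of ⟨kv, y⟩ over the isotropy group of `x` has kv ∈ 𝔞: its 𝔞ᗮ-component will be
  -- written ξy and shown to vanish.
  obtain ⟨k, ⟨hkG, hkx⟩, hkmax⟩ := hK.exists_isMaxOn ⟨1, G.one_mem, one_smul _ x⟩
    ((continuous_units_smul v).inner (𝕜 := ℝ) (continuous_const (y := y))).continuousOn
  replace hkx : k • x = x := hkx
  refine ⟨k, hkG, hkx, ?_⟩
  have hcrit : ∀ ζ ∈ subgroupLie G hG, ζ x = 0 → inner ℝ (ζ (k • v)) y = 0 := by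
    intro ζ hζ hζx
    refine inner_lie_apply_eq_zero_of_forall_le fun t => ?_
    obtain ⟨g, hg, hgt⟩ := hζ t
    have hgx : g • x = x := by
      change (g : V →L[ℝ] V) x = x
      rw [hgt]
      exact exp_apply_of_apply_eq_zero (by simp [hζx])
    have := hkmax (show g * k ∈ _ from ⟨G.mul_mem hg hkG, by
      rw [Set.mem_ofPred_eq, mul_smul, hkx, hgx]⟩)
    rw [← hgt]
    exact this
  have hnormal : ∀ η ∈ subgroupLie G hG, inner ℝ (η x) (k • v) = 0 := by
    intro η hη
    rw [real_inner_comm, inner_smul_left_of_norm_smul (horth k hkG), real_inner_comm]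
    have := smul_mem_lieOrbit (G.inv_mem hkG) (mem_lieOrbit.2 ⟨η, hη, rfl⟩ : η x ∈ lieOrbit G hG x)
    rw [inv_smul_eq_iff.2 hkx.symm] at this
    exact hv _ this
  obtain ⟨a, ha, p, hp, hap⟩ := 𝔞.exists_add_mem_mem_orthogonal (k • v)
  rw [← hreg] at hp
  obtain ⟨ξ, hξ, hξp⟩ := mem_lieOrbit.1 hp
  rw [hreg] at hp
  -- Write ξx = ηy. Then |ξx|² = ⟨ξy, ηx⟩ = ⟨kv, ηx⟩ = 0, by symmetry, ηx ⟂ 𝔞 and normality of kv.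
  -- So ξ is an admissible direction in `hcrit`.
  have hξx : ξ x = 0 := by
    have hmem : ξ x ∈ lieOrbit G hG y := by
      rw [hreg]
      exact h.lieOrbit_le hx (mem_lieOrbit.2 ⟨ξ, hξ, rfl⟩ : ξ x ∈ lieOrbit G hG x)
    obtain ⟨η, hη, hηξ⟩ := mem_lieOrbit.1 hmem
    have h1 := h.inner_lie_apply_lie_apply horth hξ hη hx hy
    have h2 := hnormal η hη
    rw [hap, inner_add_right, h.inner_lie_apply hη hx ha, zero_add, real_inner_comm, ← hξp, h1,
      hηξ] at h2
    exact inner_self_eq_zero.1 h2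
  have hp0 : inner ℝ p p = 0 := by
    have h1 := hcrit ξ hξ hξx
    rw [inner_lie_apply_left horth hξ, hξp, hap, inner_add_left,
      Submodule.inner_right_of_mem_orthogonal ha hp] at h1
    linarith
  rw [hap, inner_self_eq_zero.1 hp0, add_zero]
  exact ha

/-- Two points of `𝔞` in the same orbit are conjugate under the normalizer of `𝔞`. -/
theorem IsCartanSubspace.exists_normalizer_smul_eq (h : IsCartanSubspace G 𝔞)
    (hcompact : IsCompact (G : Set (V →L[ℝ] V)ˣ)) (horth : ∀ g ∈ G, ∀ v : V, ‖g • v‖ = ‖v‖)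
    {y : V} (hy : y ∈ 𝔞) (hreg : lieOrbit G hG y = 𝔞ᗮ) {u : V} (hu : u ∈ 𝔞)
    {g : (V →L[ℝ] V)ˣ} (hg : g ∈ G) (hgu : g • u ∈ 𝔞) :
    ∃ n ∈ G, n • (𝔞 : Set V) = (𝔞 : Set V) ∧ n • u = g • u := by
  -- `g • y` is normal to the orbit of `g • u`, so an isotropy element `k` of `g • u` brings it into
  -- 𝔞. Then n = kg maps 𝔞ᗮ = 𝔤y into 𝔤(ny) ⊆ 𝔞ᗮ, whence n preserves 𝔞.
  obtain ⟨k, hk, hku, hky⟩ := h.exists_isotropy_smul_mem hcompact horth hy hreg hgu (v := g • y)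
    fun p hp => by
      rw [real_inner_comm, inner_smul_left_of_norm_smul (horth g hg), real_inner_comm]
      have := smul_mem_lieOrbit (G.inv_mem hg) hp
      rw [inv_smul_smul] at this
      exact Submodule.inner_left_of_mem_orthogonal hy (h.lieOrbit_le hu this)
  have hn : k * g ∈ G := G.mul_mem hk hg
  rw [← mul_smul] at hky
  refine ⟨k * g, hn, ?_, by rw [mul_smul, hku]⟩
  have hle : 𝔞.map (((k * g)⁻¹ : (V →L[ℝ] V)ˣ) : V →L[ℝ] V).toLinearMap ≤ 𝔞 := by
    rintro _ ⟨a, ha, rfl⟩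
    rw [← 𝔞.orthogonal_orthogonal, Submodule.mem_orthogonal']
    intro p hp
    change inner ℝ ((k * g)⁻¹ • a) p = 0
    rw [inner_smul_left_of_norm_smul (horth _ (G.inv_mem hn)), inv_inv]
    rw [← hreg] at hp
    exact Submodule.inner_right_of_mem_orthogonal ha (h.lieOrbit_le hky (smul_mem_lieOrbit hn hp))
  have hinj : Function.Injective (((k * g)⁻¹ : (V →L[ℝ] V)ˣ) : V →L[ℝ] V).toLinearMap :=
    MulAction.injective (β := V) (k * g)⁻¹
  have heq := Submodule.eq_of_le_of_finrank_eq hle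
    (Submodule.equivMapOfInjective _ hinj 𝔞).finrank_eq.symm
  rw [smul_eq_iff_eq_inv_smul]
  exact (congrArg (SetLike.coe : Submodule ℝ V → Set V) heq).symm

/-- The projection of an orbit to `𝔞` lies in the convex hull of its intersection with `𝔞`. -/
theorem IsCartanSubspace.starProjection_smul_mem_convexHull (h : IsCartanSubspace G 𝔞)
    (hcompact : IsCompact (G : Set (V →L[ℝ] V)ˣ)) (horth : ∀ g ∈ G, ∀ v : V, ‖g • v‖ = ‖v‖)
    {y : V} (hy : y ∈ 𝔞) (hreg : lieOrbit G hG y = 𝔞ᗮ) (u : V)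
    {g : (V →L[ℝ] V)ˣ} (hg : g ∈ G) :
    𝔞.starProjection (g • u) ∈
      convexHull ℝ (((fun k : (V →L[ℝ] V)ˣ => k • u) '' G) ∩ (𝔞 : Set V)) := by
  by_contra hmem
  have hT : IsCompact (((fun k : (V →L[ℝ] V)ˣ => k • u) '' G) ∩ (𝔞 : Set V)) :=
    (hcompact.image (continuous_units_smul u)).inter_right 𝔞.closed_of_finiteDimensional
  -- A separating functional is ⟨z, ·⟩; with x = π(z), its values at points of 𝔞 are those of ⟨x,
  -- ·⟩. The maximum of ⟨·, x⟩ over the orbit is attained at a vector normal to `Gx`, which the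
  -- isotropy group of `x` moves into 𝔞 without changing the value.
  obtain ⟨f, c, hfc, hcf⟩ := geometric_hahn_banach_closed_point (convex_convexHull ℝ _)
    hT.isCompact_convexHull_of_finiteDimensional.isClosed hmem
  obtain ⟨z, rfl⟩ := (InnerProductSpace.toDual ℝ V).surjective f
  simp only [InnerProductSpace.toDual_apply_apply] at hfc hcf
  have hx : 𝔞.starProjection z ∈ 𝔞 := 𝔞.starProjection_apply_mem z
  obtain ⟨k, hk, hkmax⟩ := hcompact.exists_isMaxOn ⟨1, G.one_mem⟩
    ((continuous_units_smul u).inner (𝕜 := ℝ) (continuous_const (y := 𝔞.starProjection z))).continuousOn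
  obtain ⟨s, hs, hsx, hsk⟩ := h.exists_isotropy_smul_mem hcompact horth hy hreg hx (v := k • u) <| by
    rintro _ ⟨η, hη, rfl⟩
    have h0 : inner ℝ (η (k • u)) (𝔞.starProjection z) = 0 := by
      refine inner_lie_apply_eq_zero_of_forall_le fun t => ?_
      obtain ⟨r, hr, hrt⟩ := hη t
      have := hkmax (G.mul_mem hr hk)
      rw [← hrt]
      exact this
    rw [inner_lie_apply_left horth hη, real_inner_comm] at h0
    exact neg_eq_zero.1 h0
  have h1 := hfc _ (subset_convexHull ℝ _ ⟨⟨s * k, G.mul_mem hs hk, mul_smul s k u⟩, hsk⟩)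
  have h2 : inner ℝ z (s • k • u) = inner ℝ (k • u) (𝔞.starProjection z) := by
    rw [← 𝔞.starProjection_eq_self_iff.2 hsk, ← 𝔞.inner_starProjection_left_eq_right]
    nth_rw 1 [← hsx]
    rw [inner_smul_smul_of_norm_smul (horth s hs), real_inner_comm]
  have h3 : inner ℝ z (𝔞.starProjection (g • u)) = inner ℝ (g • u) (𝔞.starProjection z) := by
    rw [← 𝔞.inner_starProjection_left_eq_right, real_inner_comm]
  have h4 : inner ℝ (g • u) (𝔞.starProjection z) ≤ inner ℝ (k • u) (𝔞.starProjection z) :=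
    hkmax hg
  linarith

theorem IsCartanSubspace.starProjection_image (h : IsCartanSubspace G 𝔞)
    (hcompact : IsCompact (G : Set (V →L[ℝ] V)ˣ)) (horth : ∀ g ∈ G, ∀ v : V, ‖g • v‖ = ‖v‖)
    {y : V} (hy : y ∈ 𝔞) (hreg : lieOrbit G hG y = 𝔞ᗮ) {A : Set V}
    (hA : A ∈ invariantConvexSets G) : 𝔞.starProjection '' A = A ∩ (𝔞 : Set V) := by
  refine Set.Subset.antisymm ?_ fun a ha => ⟨a, ha.1, 𝔞.starProjection_eq_self_iff.2 ha.2⟩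
  rintro _ ⟨v, hv, rfl⟩
  refine ⟨?_, 𝔞.starProjection_apply_mem v⟩
  have hmem := h.starProjection_smul_mem_convexHull hcompact horth hy hreg v G.one_mem
  rw [one_smul] at hmem
  refine convexHull_min ?_ hA.1 hmem
  rintro _ ⟨⟨k, hk, rfl⟩, -⟩
  exact (smul_mem_iff_of_mem_invariantConvexSets hA hk).2 hv

/-- The normalizer element that replaces `g` restricts to a Weyl group element. -/
theorem IsCartanSubspace.smul_mem_image_of_mem (h : IsCartanSubspace G 𝔞)
    (hcompact : IsCompact (G : Set (V →L[ℝ] V)ˣ)) (horth : ∀ g ∈ G, ∀ v : V, ‖g • v‖ = ‖v‖)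
    {y : V} (hy : y ∈ 𝔞) (hreg : lieOrbit G hG y = 𝔞ᗮ) {C : Set 𝔞}
    (hC : C ∈ invariantConvexSets (weylGroup G 𝔞)) {c : 𝔞} (hc : c ∈ C)
    {g : (V →L[ℝ] V)ˣ} (hg : g ∈ G) (hgc : g • (c : V) ∈ 𝔞) :
    g • (c : V) ∈ (Subtype.val '' C : Set V) := by
  obtain ⟨n, hn, hn𝔞, hnc⟩ := h.exists_normalizer_smul_eq hcompact horth hy hreg c.2 hg hgc
  obtain ⟨w, hw, hwn⟩ := exists_mem_weylGroup hn hn𝔞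
  exact ⟨w • c, (smul_mem_iff_of_mem_invariantConvexSets hC hw).2 hc, by rw [hwn, hnc]⟩

/-- Every convex set in `𝔞` invariant under the Weyl group is the trace of a `G`-invariant convex
set. -/
theorem IsCartanSubspace.exists_preimage_eq (h : IsCartanSubspace G 𝔞)
    (hcompact : IsCompact (G : Set (V →L[ℝ] V)ˣ)) (horth : ∀ g ∈ G, ∀ v : V, ‖g • v‖ = ‖v‖)
    {y : V} (hy : y ∈ 𝔞) (hreg : lieOrbit G hG y = 𝔞ᗮ) {C : Set 𝔞}
    (hC : C ∈ invariantConvexSets (weylGroup G 𝔞)) :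
    ∃ A ∈ invariantConvexSets G, (Subtype.val ⁻¹' A : Set 𝔞) = C := by
  have hproj : ∀ g ∈ G, ∀ c ∈ C,
      𝔞.starProjection (g • (c : V)) ∈ (Subtype.val '' C : Set V) := by
    intro g hg c hc
    refine convexHull_min ?_ (hC.1.linear_image 𝔞.subtype)
      (h.starProjection_smul_mem_convexHull hcompact horth hy hreg (c : V) hg)
    rintro _ ⟨⟨k, hk, rfl⟩, hkc⟩
    exact h.smul_mem_image_of_mem hcompact horth hy hreg hC hc hk hkc
  refine ⟨{v | ∃ g ∈ G, ∃ c ∈ C, g • (c : V) = v},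
    mem_invariantConvexSets_of_forall_smul_mem ?_ ?_, ?_⟩
  · rintro _ ⟨g₁, hg₁, c₁, hc₁, rfl⟩ _ ⟨g₂, hg₂, c₂, hc₂, rfl⟩ r s hr hs hrs
    -- Once moved into 𝔞, the combination equals its own projection, a convex combination of
    -- projected orbit points, which lie in `C` by `hproj`.
    obtain ⟨g, hg, hg𝔞⟩ := h.exists_smul_mem (r • g₁ • (c₁ : V) + s • g₂ • (c₂ : V))
    have hexp : g • (r • g₁ • (c₁ : V) + s • g₂ • (c₂ : V))
        = r • 𝔞.starProjection ((g * g₁) • (c₁ : V))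
          + s • 𝔞.starProjection ((g * g₂) • (c₂ : V)) := by
      rw [← 𝔞.starProjection_eq_self_iff.2 hg𝔞, mul_smul, mul_smul, ← map_smul, ← map_smul,
        ← map_add, smul_add, smul_comm g r, smul_comm g s]
    obtain ⟨c, hc, hcg⟩ := hC.1.linear_image 𝔞.subtype (hproj _ (G.mul_mem hg hg₁) c₁ hc₁)
      (hproj _ (G.mul_mem hg hg₂) c₂ hc₂) hr hs hrs
    refine ⟨g⁻¹, G.inv_mem hg, c, hc, ?_⟩
    rw [inv_smul_eq_iff, hexp]
    exact hcg
  · rintro k hk _ ⟨g, hg, c, hc, rfl⟩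
    exact ⟨k * g, G.mul_mem hk hg, c, hc, mul_smul k g _⟩
  · refine Set.Subset.antisymm ?_ fun c hc => ⟨1, G.one_mem, c, hc, one_smul _ _⟩
    rintro a ⟨g, hg, c, hc, hgc⟩
    obtain ⟨d, hd, hdc⟩ := h.smul_mem_image_of_mem hcompact horth hy hreg hC hc hg
      (hgc ▸ a.2)
    rwa [← Subtype.ext (hdc.trans hgc)]

theorem preimage_add_of_starProjection_image {A B : Set V}
    (hA : 𝔞.starProjection '' A = A ∩ (𝔞 : Set V))
    (hB : 𝔞.starProjection '' B = B ∩ (𝔞 : Set V)) :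
    (Subtype.val ⁻¹' (A + B) : Set 𝔞) = Subtype.val ⁻¹' A + Subtype.val ⁻¹' B := by
  refine Set.Subset.antisymm ?_ ?_
  · rintro x ⟨a, ha, b, hb, hab⟩
    have ha' : 𝔞.starProjection a ∈ A ∩ (𝔞 : Set V) := hA ▸ Set.mem_image_of_mem _ ha
    have hb' : 𝔞.starProjection b ∈ B ∩ (𝔞 : Set V) := hB ▸ Set.mem_image_of_mem _ hb
    refine ⟨⟨_, ha'.2⟩, ha'.1, ⟨_, hb'.2⟩, hb'.1, Subtype.ext ?_⟩
    change 𝔞.starProjection a + 𝔞.starProjection b = x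
    rw [← map_add, ← 𝔞.starProjection_eq_self_iff.2 x.2]
    exact congrArg _ hab
  · rintro _ ⟨a, ha, b, hb, rfl⟩
    exact ⟨a, ha, b, hb, rfl⟩

end PolarConvexity

/-! ### The semigroup isomorphism -/

theorem proposition1 {V : Type*} [NormedAddCommGroup V] [InnerProductSpace ℝ V]
    [FiniteDimensional ℝ V] (G : Subgroup (V →L[ℝ] V)ˣ)
    (hcompact : IsCompact (G : Set (V →L[ℝ] V)ˣ))
    (horthogonal : ∀ g ∈ G, ∀ v : V, ‖g • v‖ = ‖v‖)
    (𝔞 : Submodule ℝ V) (h𝔞 : IsCartanSubspace G 𝔞) :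
    (∃ Φ : invariantConvexSets G ≃+ invariantConvexSets (weylGroup G 𝔞),
      ∀ A : invariantConvexSets G,
        (Subtype.val '' (Φ A : Set 𝔞) : Set V) = (A : Set V) ∩ (𝔞 : Set V)) ∧
    ∀ A ∈ invariantConvexSets G, 𝔞.starProjection '' A = A ∩ (𝔞 : Set V) := by
  have hG : IsClosed (Units.val '' (G : Set (V →L[ℝ] V)ˣ)) :=
    (hcompact.image Units.continuous_val).isClosed
  obtain ⟨y, hy, hreg⟩ := h𝔞.exists_lieOrbit_eq hcompact horthogonal hG
  have hproj : ∀ A ∈ invariantConvexSets G, 𝔞.starProjection '' A = A ∩ (𝔞 : Set V) :=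
    fun A hA => h𝔞.starProjection_image hcompact horthogonal hy hreg hA
  let φ : AddHom (invariantConvexSets G) (invariantConvexSets (weylGroup G 𝔞)) :=
    { toFun := fun A => ⟨Subtype.val ⁻¹' (A : Set V), preimage_mem_invariantConvexSets A.2⟩
      map_add' := fun A B => Subtype.ext
        (preimage_add_of_starProjection_image (hproj A A.2) (hproj B B.2)) }
  have hφ : Function.Bijective φ := by
    refine ⟨fun A B hAB => ?_, fun C => ?_⟩
    · have hAB' : (Subtype.val ⁻¹' (A : Set V) : Set 𝔞) = Subtype.val ⁻¹' (B : Set V) :=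
        congrArg Subtype.val hAB
      exact Subtype.ext (Set.Subset.antisymm
        (h𝔞.subset_of_preimage_subset A.2 B.2 hAB'.subset)
        (h𝔞.subset_of_preimage_subset B.2 A.2 hAB'.symm.subset))
    · obtain ⟨A, hA, hAC⟩ := h𝔞.exists_preimage_eq hcompact horthogonal hy hreg C.2
      exact ⟨⟨A, hA⟩, Subtype.ext hAC⟩
  refine ⟨⟨AddEquiv.ofBijective φ hφ, fun A => ?_⟩, hproj⟩
  change (Subtype.val '' (Subtype.val ⁻¹' (A : Set V) : Set 𝔞) : Set V) = _
  exact (Subtype.image_preimage_coe (𝔞 : Set V) (A : Set V)).trans (Set.inter_comm _ _)
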